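/- A universe of separations is a finite lattice $(\vec U,\le,\vee,\wedge)$ with an order-reversing involution $\vec s\mapsto \vec s^{\,*}$; an unoriented separation is a pair $s=\{\vec s,\vec s^{\,*}\}$, the elements of $s$ are its orientations, and $U$ denotes the set of all unoriented separations. For $T\subseteq U$ let $\vec T$ be the set of all orientations of elements of $T$. Two unoriented separations $r,s$ are nested if they have orientations with $\vec r\le\vec s$, and $T$ is nested if its elements are pairwise nested. The universe is submodular if it comes with a function $|\cdot|\colon\vec U\to\mathbb N_0$ with $|\vec s|=|\vec s^{\,*}|$ and $|\vec s\vee\vec t\,|+|\vec s\wedge\vec t\,|\le|\vec s|+|\vec t\,|$ for all $\vec s,\vec t\in\vec U$, and distributive if its lattice is distributive. For $k\in\mathbb N_0$ let $\vec S_k=\{\vec s\in\vec U:|\vec s|<k\}$. A $k$-profile is a set $P\subseteq\vec S_k$ that - contains, for each $\vec s\in\vec S_k$, at least one of $\vec s,\vec s^{\,*}$, and contains both only if $\vec s=\vec s^{\,*}$; - is consistent: there are no $\vec r,\vec s\in P$ with $\vec r^{\,*}\le\vec s$ and $r\ne s$; and - satisfies $\vec r^{\,*}\wedge\vec s^{\,*}\notin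 P$ for all $\vec r,\vec s\in P$. A profile in $\vec U$ is a $k$-profile for some $k$. A profile $P$ is strongly robust if, for all $\vec s\in P$ and $\vec r\in\vec U$ with $|\vec s\vee\vec r\,|\le|\vec s|$ and $|\vec s\vee\vec r^{\,*}|\le|\vec s|$, at least one of $\vec s\vee\vec r$ and $\vec s\vee\vec r^{\,*}$ lies in $P$. An unoriented separation $s$ distinguishes $P$ and $Q$ if it has an orientation $\vec s$ with $\vec s\in P$ and $\vec s^{\,*}\in Q$. A set of profiles is distinguishable if every two distinct elements of it are distinguished by some $s\in U$. **Theorem (tree-of-tangles theorem for different orders).** Let $\vec U$ be a submodular distributive universe of separations. Then for every distinguishable set $\mathcal P$ of strongly robust profiles in $\vec U$ (possibly of different orders $k$) there is a nested set $T\subseteq U$ of separations such that 1. every two distinct profiles in $\mathcal P$ are distinguished by some separation in $T$; 2. for every $P\in\mathcal P$, every $\le$-maximal element $\vec s$ of $P\cap\vec T$ and every $\vec s{\,}'\in P$ with $\vec s\le\vec s{\,}'$, we have $|\vec s|\le|\vec s{\,}'|$. -/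

import Mathlib

/-!
Every two profiles in the family are distinguished by separations of least possible order. The
splinter lemma turns the sets of these efficient distinguishers, one for each pair of profiles, into
a nested set `T` that meets all of them. Its hypothesis asks that for crossing separations `r` and
`s`, efficient distinguishers of two pairs with `|r| ≤ |s|`, either `r` or a corner of `r` and `s`
efficiently distinguish the pair of `s`. If `r` does not distinguish that pair, both of its profiles
agree on `r`, and robustness of one of the profiles distinguished by `r` provides a corner of
small order.

Such a `T` also satisfies the maximality condition: if `s` is maximal in `P ∩ T`, distinguishes
`P'` from `Q` efficiently, and some `s' ∈ P` above `s` had smaller order, then `s'` would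
distinguish `P` from `Q`, and the separation of `T` distinguishing `P` from `Q` efficiently would
lie strictly above `s`.
-/

namespace SeparationTheory

/-- A universe of separations: a lattice of oriented separations with an order-reversing
involution `s ↦ s⁻¹`, sending an oriented separation to its inverse. (Finiteness is added as the
instance `[Finite U]` where it is needed.) -/
class SeparationUniverse (U : Type*) extends Lattice U, InvolutiveInv U where
  inv_le_inv_of_le : ∀ {r s : U}, r ≤ s → s⁻¹ ≤ r⁻¹

variable {U : Type*} [SeparationUniverse U]

/-- The universe is distributive. -/
def IsDistributive (U : Type*) [SeparationUniverse U] : Prop :=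
  ∀ r s t : U, r ⊔ (s ⊓ t) = (r ⊔ s) ⊓ (r ⊔ t)

/-- A submodular order function on a universe of separations. -/
structure SubmodularOrder (U : Type*) [SeparationUniverse U] where
  order : U → ℕ
  order_inv : ∀ s : U, order s⁻¹ = order s
  submodular : ∀ s t : U, order (s ⊔ t) + order (s ⊓ t) ≤ order s + order t

/-- The oriented separations of order less than `k`. -/
def SubmodularOrder.below (ω : SubmodularOrder U) (k : ℕ) : Set U := {s | ω.order s < k}

/-- Unoriented separations: the pairs `{s, s⁻¹}`. -/
abbrev UnorientedSeparation (U : Type*) [SeparationUniverse U] : Type _ :=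
  {p : Sym2 U // ∃ s : U, p = s(s, s⁻¹)}

/-- The unoriented separation underlying an oriented separation. -/
def underlying (s : U) : UnorientedSeparation U := ⟨s(s, s⁻¹), s, rfl⟩

/-- All orientations of the elements of a set of unoriented separations. -/
def orientationsOf (T : Set (UnorientedSeparation U)) : Set U := {s | underlying s ∈ T}

/-- Two unoriented separations are nested if they have comparable orientations. -/
def Nested (r s : UnorientedSeparation U) : Prop :=
  ∃ r' s' : U, underlying r' = r ∧ underlying s' = s ∧ r' ≤ s'

/-- A set of unoriented separations is nested if its elements are pairwise nested. -/
def IsNestedSet (T : Set (UnorientedSeparation U)) : Prop :=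
  ∀ r ∈ T, ∀ s ∈ T, Nested r s

/-- `O` is an orientation of `S`, the set of oriented separations of a separation system: it
contains an orientation of each separation, and both `s` and `s⁻¹` only if these coincide. -/
structure IsOrientation (S O : Set U) : Prop where
  subset : O ⊆ S
  antisymmetric : ∀ s ∈ O, s⁻¹ ∈ O → s⁻¹ = s
  orients : ∀ s ∈ S, s ∈ O ∨ s⁻¹ ∈ O

/-- `O` contains no `r`, `s` with `r⁻¹ ≤ s` whose underlying separations are distinct. -/
def IsConsistent (O : Set U) : Prop :=
  ∀ r ∈ O, ∀ s ∈ O, r⁻¹ ≤ s → underlying r = underlying s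

/-- A profile of `S`: a consistent orientation of `S` with the profile property. -/
structure IsProfile (S P : Set U) : Prop where
  isOrientation : IsOrientation S P
  isConsistent : IsConsistent P
  profile_property : ∀ r ∈ P, ∀ s ∈ P, r⁻¹ ⊓ s⁻¹ ∉ P

/-- A profile in a submodular universe: a `k`-profile for some `k`. -/
def SubmodularOrder.IsProfileIn (ω : SubmodularOrder U) (P : Set U) : Prop :=
  ∃ k : ℕ, IsProfile (ω.below k) P

/-- Strong robustness. -/
def SubmodularOrder.IsStronglyRobust (ω : SubmodularOrder U) (P : Set U) : Prop :=
  ∀ s ∈ P, ∀ r : U, ω.order (s ⊔ r) ≤ ω.order s → ω.order (s ⊔ r⁻¹) ≤ ω.order s →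
    s ⊔ r ∈ P ∨ s ⊔ r⁻¹ ∈ P

/-- The unoriented separation `s` distinguishes `P` and `Q`. -/
def Distinguishes (s : UnorientedSeparation U) (P Q : Set U) : Prop :=
  ∃ s' : U, underlying s' = s ∧ s' ∈ P ∧ s'⁻¹ ∈ Q

/-- Some separation distinguishes `P` and `Q`. -/
def Distinguishable (P Q : Set U) : Prop :=
  ∃ s : UnorientedSeparation U, Distinguishes s P Q

end SeparationTheory

namespace SeparationTheory

section Splinter

variable {α ι : Type*} {N : α → α → Prop}

/-- A corner of `r` and `s` with respect to a relation `N` of nestedness, as an abstraction of the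
four suprema of orientations of two crossing separations. -/
structure IsCorner (N : α → α → Prop) (r s c : α) : Prop where
  left : N c r
  right : N c s
  rel : ∀ t, N t r → N t s → N t c

theorem IsCorner.symm {r s c : α} (h : IsCorner N r s c) : IsCorner N s r c :=
  ⟨h.right, h.left, fun t hs hr => h.rel t hr hs⟩

/-- The hypothesis of the splinter lemma, for two members of the family: of any two crossing
elements of `A` and `B`, one lies in both sets or there is a corner in one of them. -/
def Splinters (N : α → α → Prop) (A B : Set α) : Prop :=
  ∀ r ∈ A, ∀ s ∈ B, ¬ N r s → r ∈ B ∨ s ∈ A ∨ ∃ c ∈ A ∪ B, IsCorner N r s c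

theorem Splinters.inter_rel {A B : Set α} (h : Splinters N A B) (x : α) :
    Splinters N (A ∩ {y | N x y}) (B ∩ {y | N x y}) := by
  rintro r ⟨hrA, hxr⟩ s ⟨hsB, hxs⟩ hrs
  obtain hrB | hsA | ⟨c, hc, hcorner⟩ := h r hrA s hsB hrs
  · exact .inl ⟨hrB, hxr⟩
  · exact .inr (.inl ⟨hsA, hxs⟩)
  · have hxc : N x c := hcorner.rel x hxr hxs
    exact .inr (.inr ⟨c, hc.imp (⟨·, hxc⟩) (⟨·, hxc⟩), hcorner⟩)

theorem exists_mem_forall_exists_rel [Std.Refl N] [Std.Symm N] {T : Finset α}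
    (hT : ∀ x ∈ T, ∀ y ∈ T, N x y) {B : Set α} (hB : B.Nonempty) :
    ∃ x ∈ B, ∀ A, (∃ a ∈ T, a ∈ A) → Splinters N B A → ∃ y ∈ A, N x y := by
  classical
  by_cases hTB : ∃ x ∈ T, x ∈ B
  · obtain ⟨x, hxT, hxB⟩ := hTB
    exact ⟨x, hxB, fun A ⟨a, haT, haA⟩ _ => ⟨a, haA, hT x hxT a haT⟩⟩
  -- A corner of `x` and an element of `T` crosses fewer elements of `T` than `x` does, so it is not
  -- in `B` if `x` crosses as few of them as possible.
  let crossing (x : α) : Finset α := {t ∈ T | ¬ N t x}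
  obtain ⟨x, hxB, hmin⟩ := exists_minimalFor_of_wellFoundedLT (· ∈ B) crossing hB
  refine ⟨x, hxB, fun A ⟨a, haT, haA⟩ hBA => ?_⟩
  by_cases hxa : N x a
  · exact ⟨a, haA, hxa⟩
  obtain hxA | haB | ⟨c, hcB | hcA, hc⟩ := hBA x hxB a haA hxa
  · exact ⟨x, hxA, refl x⟩
  · exact absurd ⟨a, haT, haB⟩ hTB
  · have hsubset : crossing c ⊆ crossing x :=
      Finset.monotone_filter_right T fun t htT htc htx => htc (hc.rel t htx (hT t htT a haT))
    have ha : a ∈ crossing x := Finset.mem_filter.2 ⟨haT, fun hax => hxa (symm hax)⟩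
    exact absurd (symm hc.right) (Finset.mem_filter.1 (hmin hcB hsubset ha)).2
  · exact ⟨c, hcA, symm hc.left⟩

theorem exists_nested_transversal [Finite ι] [Std.Refl N] [Std.Symm N] {A : ι → Set α}
    (hne : ∀ i, (A i).Nonempty) (hA : ∀ i j, Splinters N (A i) (A j)) :
    ∃ T : Finset α, (∀ x ∈ T, ∀ y ∈ T, N x y) ∧ (∀ i, ∃ x ∈ T, x ∈ A i) ∧
      ∀ x ∈ T, ∃ i, x ∈ A i := by
  classical
  induction ι using Finite.induction_empty_option with
  | of_equiv e ih =>
    obtain ⟨T, hT, hmeet, hsub⟩ := ih (A := A ∘ e) (fun i => hne (e i)) fun i j => hA (e i) (e j)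
    exact ⟨T, hT, e.surjective.forall.2 hmeet, fun x hx => (hsub x hx).imp' e fun _ => id⟩
  | h_empty => exact ⟨∅, by simp⟩
  | h_option ih =>
    obtain ⟨T, hT, hmeet, -⟩ := ih (fun i => hne (some i)) fun i j => hA (some i) (some j)
    obtain ⟨x, hx, hxA⟩ := exists_mem_forall_exists_rel hT (hne none)
    obtain ⟨T', hT', hmeet', hsub'⟩ := ih (A := fun i => A (some i) ∩ {y | N x y})
      (fun i => hxA _ (hmeet i) (hA none (some i)))
      fun i j => (hA (some i) (some j)).inter_rel x
    have hxT' : ∀ y ∈ T', N x y := fun y hy => (hsub' y hy).choose_spec.2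
    refine ⟨insert x T', ?_, ?_, ?_⟩
    · simp only [Finset.forall_mem_insert]
      exact ⟨⟨refl x, hxT'⟩, fun y hy => ⟨symm (hxT' y hy), hT' y hy⟩⟩
    · refine Option.forall.2 ⟨⟨x, T'.mem_insert_self x, hx⟩, fun i => ?_⟩
      obtain ⟨y, hyT', hy, -⟩ := hmeet' i
      exact ⟨y, Finset.mem_insert_of_mem hyT', hy⟩
    · simp only [Finset.forall_mem_insert]
      exact ⟨⟨none, hx⟩, fun y hy => (hsub' y hy).imp' some fun _ => And.left⟩

end Splinter

variable {U : Type*} [SeparationUniverse U]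

section Involution

variable {r s : U}

theorem inv_le_inv_iff : r⁻¹ ≤ s⁻¹ ↔ s ≤ r :=
  ⟨fun h => by simpa only [inv_inv] using SeparationUniverse.inv_le_inv_of_le h,
    SeparationUniverse.inv_le_inv_of_le⟩

theorem le_inv_comm : r ≤ s⁻¹ ↔ s ≤ r⁻¹ := by
  rw [← inv_le_inv_iff (s := r), inv_inv]

theorem inv_sup (r s : U) : (r ⊔ s)⁻¹ = r⁻¹ ⊓ s⁻¹ :=
  le_antisymm (le_inf (inv_le_inv_iff.2 le_sup_left) (inv_le_inv_iff.2 le_sup_right))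
    (le_inv_comm.1 (sup_le (le_inv_comm.1 inf_le_left) (le_inv_comm.1 inf_le_right)))

theorem inv_inf (r s : U) : (r ⊓ s)⁻¹ = r⁻¹ ⊔ s⁻¹ := by
  rw [← inv_inj, inv_sup, inv_inv, inv_inv, inv_inv]

theorem underlying_eq_underlying_iff : underlying r = underlying s ↔ r = s ∨ r = s⁻¹ := by
  rw [Subtype.ext_iff]
  simp only [underlying, Sym2.eq_iff, inv_eq_iff_eq_inv, inv_inv, and_self]

@[simp]
theorem underlying_inv (s : U) : underlying s⁻¹ = underlying s :=
  underlying_eq_underlying_iff.2 (.inr rfl)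

end Involution

section Nested

theorem nested_of_le {r s : U} (h : r ≤ s) : Nested (underlying r) (underlying s) :=
  ⟨r, s, rfl, rfl, h⟩

theorem nested_underlying_iff {r s : U} : Nested (underlying r) (underlying s) ↔
    r ≤ s ∨ r⁻¹ ≤ s ∨ s ≤ r ∨ s ≤ r⁻¹ := by
  constructor
  · rintro ⟨r', s', hr, hs, h⟩
    obtain rfl | rfl := underlying_eq_underlying_iff.1 hr <;>
      obtain rfl | rfl := underlying_eq_underlying_iff.1 hs
    · exact .inl h
    · exact .inr (.inr (.inr (le_inv_comm.1 h)))
    · exact .inr (.inl h)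
    · exact .inr (.inr (.inl (inv_le_inv_iff.1 h)))
  · rintro (h | h | h | h)
    · exact nested_of_le h
    · simpa only [underlying_inv] using nested_of_le h
    · simpa only [underlying_inv] using nested_of_le (inv_le_inv_iff.2 h)
    · simpa only [underlying_inv] using nested_of_le (le_inv_comm.1 h)

instance : Std.Refl (Nested (U := U)) where
  refl := by
    rintro ⟨_, s, rfl⟩
    exact nested_of_le le_rfl

instance : Std.Symm (Nested (U := U)) where
  symm := by
    rintro _ _ ⟨r, s, rfl, rfl, h⟩
    simpa only [underlying_inv] using nested_of_le (inv_le_inv_iff.2 h)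

theorem isCorner_sup {r s : U} (hrs : ¬ Nested (underlying r) (underlying s)) :
    IsCorner Nested (underlying r) (underlying s) (underlying (r ⊔ s)) where
  left := symm (nested_of_le le_sup_left)
  right := symm (nested_of_le le_sup_right)
  rel := by
    rintro ⟨_, t, rfl⟩ htr hts
    change Nested (underlying t) _ at htr hts ⊢
    rw [nested_underlying_iff] at hrs htr hts ⊢
    rcases htr with h | h | hr | hr
    · exact .inl (h.trans le_sup_left)
    · exact .inr (.inl (h.trans le_sup_left))
    · rcases hts with h | h | hs | hs
      · exact .inl (h.trans le_sup_right)
      · exact .inr (.inl (h.trans le_sup_right))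
      · exact .inr (.inr (.inl (sup_le hr hs)))
      · exact absurd (.inr (.inr (.inr (hs.trans (inv_le_inv_iff.2 hr))))) hrs
    · rcases hts with h | h | hs | hs
      · exact .inl (h.trans le_sup_right)
      · exact .inr (.inl (h.trans le_sup_right))
      · exact absurd (.inr (.inr (.inr (hs.trans (le_inv_comm.1 hr))))) hrs
      · exact .inr (.inr (.inr (sup_le hr hs)))

end Nested

section Profiles

variable {ω : SubmodularOrder U} {P Q P' Q' : Set U} {r s t : U}

theorem IsConsistent.order_eq (hP : IsConsistent P) (hr : r ∈ P) (hs : s ∈ P) (h : r⁻¹ ≤ s) :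
    ω.order r = ω.order s := by
  obtain rfl | rfl := underlying_eq_underlying_iff.1 (hP r hr s hs h)
  · rfl
  · exact ω.order_inv s

namespace SubmodularOrder

theorem IsProfileIn.isConsistent (hP : ω.IsProfileIn P) : IsConsistent P :=
  let ⟨_, hk⟩ := hP
  hk.isConsistent

theorem IsProfileIn.mem_or_inv_mem (hP : ω.IsProfileIn P) (hs : s ∈ P)
    (h : ω.order t ≤ ω.order s) : t ∈ P ∨ t⁻¹ ∈ P :=
  let ⟨_, hk⟩ := hP
  hk.isOrientation.orients t (h.trans_lt (hk.isOrientation.subset hs))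

theorem IsProfileIn.sup_mem (hP : ω.IsProfileIn P) (hr : r ∈ P) (hs : s ∈ P)
    (h : ω.order (r ⊔ s) ≤ ω.order s) : r ⊔ s ∈ P := by
  refine (hP.mem_or_inv_mem hs h).resolve_right fun hinv => ?_
  obtain ⟨k, hk⟩ := hP
  exact hk.profile_property r hr s hs (inv_sup r s ▸ hinv)

theorem IsProfileIn.mem_of_le_of_order_lt (hP : ω.IsProfileIn P) (hs : s ∈ P) (hts : t ≤ s)
    (h : ω.order t < ω.order s) : t ∈ P := by
  refine (hP.mem_or_inv_mem hs h.le).resolve_right fun ht => h.ne ?_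
  rw [← ω.order_inv t]
  exact hP.isConsistent.order_eq ht hs (by rwa [inv_inv])

/-- Robustness as it is usually required of profiles: the two corners must have order less than
`s`, whereas strong robustness also concerns corners of the same order as `s`. -/
def IsRobust (ω : SubmodularOrder U) (P : Set U) : Prop :=
  ∀ s ∈ P, ∀ r : U, ω.order (s ⊔ r) < ω.order s → ω.order (s ⊔ r⁻¹) < ω.order s →
    s ⊔ r ∈ P ∨ s ⊔ r⁻¹ ∈ P

theorem IsStronglyRobust.isRobust (hP : ω.IsStronglyRobust P) : ω.IsRobust P :=
  fun s hs r h h' => hP s hs r h.le h'.le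

/-- The oriented separation `s` distinguishes `P` from `Q`, and has minimum order with this
property. -/
structure EfficientlyDistinguishes (ω : SubmodularOrder U) (s : U) (P Q : Set U) : Prop where
  mem : s ∈ P
  inv_mem : s⁻¹ ∈ Q
  order_le : ∀ t ∈ P, t⁻¹ ∈ Q → ω.order s ≤ ω.order t

namespace EfficientlyDistinguishes

protected theorem inv (h : ω.EfficientlyDistinguishes s P Q) :
    ω.EfficientlyDistinguishes s⁻¹ Q P where
  mem := h.inv_mem
  inv_mem := (inv_inv s).symm ▸ h.mem
  order_le t htQ htP := by
    simpa only [ω.order_inv] using h.order_le t⁻¹ htP ((inv_inv t).symm ▸ htQ)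

theorem of_order_le (hs : ω.EfficientlyDistinguishes s P Q) (htP : t ∈ P) (htQ : t⁻¹ ∈ Q)
    (h : ω.order t ≤ ω.order s) : ω.EfficientlyDistinguishes t P Q :=
  ⟨htP, htQ, fun u huP huQ => h.trans (hs.order_le u huP huQ)⟩

theorem order_le_order_sup (hQ : ω.IsProfileIn Q) (hs : ω.EfficientlyDistinguishes s P Q)
    (h : s ⊔ t ∈ P) : ω.order s ≤ ω.order (s ⊔ t) := by
  by_contra! hlt
  have hmem : (s ⊔ t)⁻¹ ∈ Q := hQ.mem_of_le_of_order_lt hs.inv_mem (inv_le_inv_iff.2 le_sup_left)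
    (by rwa [ω.order_inv, ω.order_inv])
  exact hlt.not_ge (hs.order_le _ h hmem)

theorem order_le_order_sup_or (hP : ω.IsRobust P) (hQ : ω.IsProfileIn Q)
    (hs : ω.EfficientlyDistinguishes s P Q) (t : U) :
    ω.order s ≤ ω.order (s ⊔ t) ∨ ω.order s ≤ ω.order (s ⊔ t⁻¹) := by
  by_contra! ⟨hlt, hlt'⟩
  obtain h | h := hP s hs.mem t hlt hlt'
  · exact hlt.not_ge (hs.order_le_order_sup hQ h)
  · exact hlt'.not_ge (hs.order_le_order_sup hQ h)

theorem order_sup_le_or (hP : ω.IsProfileIn P) (hQ : ω.IsRobust Q)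
    (hr : ω.EfficientlyDistinguishes r P Q) (s : U) :
    ω.order (r ⊔ s) ≤ ω.order s ∨ ω.order (r ⊔ s⁻¹) ≤ ω.order s⁻¹ := by
  have horder_inf (x y : U) : ω.order (x⁻¹ ⊔ y⁻¹) = ω.order (x ⊓ y) := by
    rw [← inv_inf, ω.order_inv]
  obtain h | h := hr.inv.order_le_order_sup_or hQ hP s⁻¹
  · left
    rw [horder_inf, ω.order_inv] at h
    linarith [ω.submodular r s]
  · right
    rw [horder_inf, ω.order_inv] at h
    linarith [ω.submodular r s⁻¹]

theorem sup (hP : ω.IsProfileIn P) (hQ : ω.IsProfileIn Q)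
    (hs : ω.EfficientlyDistinguishes s P Q) (hrP : r ∈ P)
    (hrs : ¬ Nested (underlying r) (underlying s)) (h : ω.order (r ⊔ s) ≤ ω.order s) :
    ω.EfficientlyDistinguishes (r ⊔ s) P Q := by
  refine hs.of_order_le (hP.sup_mem hrP hs.mem h) ?_ h
  have horder : ω.order (r ⊔ s) ≤ ω.order s⁻¹ := h.trans_eq (ω.order_inv s).symm
  refine (hQ.mem_or_inv_mem hs.inv_mem horder).resolve_left fun hmem => hrs ?_
  have heq : underlying s⁻¹ = underlying (r ⊔ s) :=
    hQ.isConsistent _ hs.inv_mem _ hmem ((inv_inv s).trans_le le_sup_right)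
  rw [← underlying_inv s, heq]
  exact nested_of_le le_sup_left

theorem exists_isCorner (hP : ω.IsProfileIn P) (hQ : ω.IsRobust Q) (hP' : ω.IsProfileIn P')
    (hQ' : ω.IsProfileIn Q') (hr : ω.EfficientlyDistinguishes r P Q)
    (hs : ω.EfficientlyDistinguishes s P' Q') (hrs : ¬ Nested (underlying r) (underlying s))
    (hrP' : r ∈ P') (hrQ' : r ∈ Q') :
    ∃ c, ω.EfficientlyDistinguishes c P' Q' ∧
      IsCorner Nested (underlying r) (underlying s) (underlying c) := by
  obtain h | h := hr.order_sup_le_or hP hQ s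
  · exact ⟨r ⊔ s, hs.sup hP' hQ' hrP' hrs h, isCorner_sup hrs⟩
  · have hrs' : ¬ Nested (underlying r) (underlying s⁻¹) := by rwa [underlying_inv]
    exact ⟨(r ⊔ s⁻¹)⁻¹, (hs.inv.sup hQ' hP' hrQ' hrs' h).inv,
      by simpa only [underlying_inv] using isCorner_sup hrs'⟩

theorem exists_underlying_eq_or_isCorner (hP : ω.IsProfileIn P) (hQ : ω.IsProfileIn Q)
    (hP' : ω.IsProfileIn P') (hQ' : ω.IsProfileIn Q') (hPr : ω.IsRobust P) (hQr : ω.IsRobust Q)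
    (hr : ω.EfficientlyDistinguishes r P Q) (hs : ω.EfficientlyDistinguishes s P' Q')
    (hrs : ¬ Nested (underlying r) (underlying s)) (hle : ω.order r ≤ ω.order s) :
    ∃ c, ω.EfficientlyDistinguishes c P' Q' ∧ (underlying c = underlying r ∨
      IsCorner Nested (underlying r) (underlying s) (underlying c)) := by
  have hle' : ω.order r⁻¹ ≤ ω.order s := (ω.order_inv r).trans_le hle
  obtain hrP' | hrP' := hP'.mem_or_inv_mem hs.mem hle <;>
    obtain hrQ' | hrQ' := hQ'.mem_or_inv_mem hs.inv_mem (hle.trans_eq (ω.order_inv s).symm)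
  · obtain ⟨c, hc, hcorner⟩ := hr.exists_isCorner hP hQr hP' hQ' hs hrs hrP' hrQ'
    exact ⟨c, hc, .inr hcorner⟩
  · exact ⟨r, hs.of_order_le hrP' hrQ' hle, .inl rfl⟩
  · exact ⟨r⁻¹, hs.of_order_le hrP' (by rwa [inv_inv]) hle', .inl (underlying_inv r)⟩
  · rw [← underlying_inv r] at hrs
    obtain ⟨c, hc, hcorner⟩ := hr.inv.exists_isCorner hQ hPr hP' hQ' hs hrs hrP' hrQ'
    exact ⟨c, hc, .inr (underlying_inv r ▸ hcorner)⟩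

end EfficientlyDistinguishes

theorem exists_efficientlyDistinguishes (ω : SubmodularOrder U) (h : Distinguishable P Q) :
    ∃ s, ω.EfficientlyDistinguishes s P Q := by
  obtain ⟨_, s, -, hs⟩ := h
  obtain ⟨m, hm, hmin⟩ :=
    exists_minimalFor_of_wellFoundedLT (fun s => s ∈ P ∧ s⁻¹ ∈ Q) ω.order ⟨s, hs⟩
  exact ⟨m, hm.1, hm.2, fun t htP htQ => (le_total _ _).elim id (hmin ⟨htP, htQ⟩)⟩

/-- The unoriented separations that distinguish `P` and `Q` with minimum order. -/
def efficientDistinguishers (ω : SubmodularOrder U) (P Q : Set U) :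
    Set (UnorientedSeparation U) :=
  underlying '' {s | ω.EfficientlyDistinguishes s P Q}

theorem splinters_efficientDistinguishers (hP : ω.IsProfileIn P) (hQ : ω.IsProfileIn Q)
    (hP' : ω.IsProfileIn P') (hQ' : ω.IsProfileIn Q') (hPr : ω.IsRobust P) (hQr : ω.IsRobust Q)
    (hPr' : ω.IsRobust P') (hQr' : ω.IsRobust Q') :
    Splinters Nested (ω.efficientDistinguishers P Q) (ω.efficientDistinguishers P' Q') := by
  rintro _ ⟨r, hr, rfl⟩ _ ⟨s, hs, rfl⟩ hrs
  obtain hle | hle := le_total (ω.order r) (ω.order s)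
  · obtain ⟨c, hc, heq | hcorner⟩ :=
      hr.exists_underlying_eq_or_isCorner hP hQ hP' hQ' hPr hQr hs hrs hle
    · exact .inl ⟨c, hc, heq⟩
    · exact .inr (.inr ⟨_, .inr ⟨c, hc, rfl⟩, hcorner⟩)
  · obtain ⟨c, hc, heq | hcorner⟩ := hs.exists_underlying_eq_or_isCorner hP' hQ' hP hQ hPr' hQr'
      hr (fun h => hrs (symm h)) hle
    · exact .inr (.inl ⟨c, hc, heq⟩)
    · exact .inr (.inr ⟨_, .inl ⟨c, hc, rfl⟩, hcorner.symm⟩)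

theorem exists_isNestedSet_efficientlyDistinguishes {Ps : Set (Set U)} (hfin : Ps.Finite)
    (hprofile : ∀ P ∈ Ps, ω.IsProfileIn P) (hrobust : ∀ P ∈ Ps, ω.IsRobust P)
    (hdist : ∀ P ∈ Ps, ∀ Q ∈ Ps, P ≠ Q → Distinguishable P Q) :
    ∃ T : Set (UnorientedSeparation U), IsNestedSet T ∧
      (∀ P ∈ Ps, ∀ Q ∈ Ps, P ≠ Q → ∃ s ∈ orientationsOf T, ω.EfficientlyDistinguishes s P Q) ∧
      ∀ s ∈ orientationsOf T, ∃ P ∈ Ps, ∃ Q ∈ Ps, ω.EfficientlyDistinguishes s P Q := by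
  have : Finite Ps.offDiag := hfin.offDiag
  obtain ⟨T, hT, hmeet, hsub⟩ := exists_nested_transversal (N := Nested)
    (A := fun p : Ps.offDiag => ω.efficientDistinguishers p.1.1 p.1.2)
    (fun ⟨_, hP, hQ, hne⟩ =>
      Set.Nonempty.image _ (ω.exists_efficientlyDistinguishes (hdist _ hP _ hQ hne)))
    fun ⟨_, hP, hQ, _⟩ ⟨_, hP', hQ', _⟩ => splinters_efficientDistinguishers
      (hprofile _ hP) (hprofile _ hQ) (hprofile _ hP') (hprofile _ hQ')
      (hrobust _ hP) (hrobust _ hQ) (hrobust _ hP') (hrobust _ hQ')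
  refine ⟨T, hT, fun P hP Q hQ hne => ?_, fun s hs => ?_⟩
  · obtain ⟨_, hsT, s, hs, rfl⟩ := hmeet ⟨(P, Q), hP, hQ, hne⟩
    exact ⟨s, hsT, hs⟩
  · obtain ⟨⟨⟨P, Q⟩, hP, hQ, _⟩, t, ht, hts⟩ := hsub _ hs
    obtain rfl | rfl := underlying_eq_underlying_iff.1 hts
    · exact ⟨P, hP, Q, hQ, ht⟩
    · exact ⟨Q, hQ, P, hP, inv_inv s ▸ ht.inv⟩

theorem EfficientlyDistinguishes.lt_of_nested (hP : ω.IsProfileIn P) (hP' : ω.IsProfileIn P')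
    (hQ : ω.IsProfileIn Q) (ht : ω.EfficientlyDistinguishes t P Q)
    (hs : ω.EfficientlyDistinguishes s P' Q) (hsP : s ∈ P)
    (hnested : Nested (underlying t) (underlying s)) (hlt : ω.order t < ω.order s) : s < t := by
  obtain hle | hle | hle | hle := nested_underlying_iff.1 hnested
  · have htP' : t ∈ P' := hP'.mem_of_le_of_order_lt hs.mem hle hlt
    exact absurd (hs.order_le t htP' ht.inv_mem) hlt.not_ge
  · exact absurd (hP.isConsistent.order_eq ht.mem hsP hle) hlt.ne
  · exact hle.lt_of_ne fun h => hlt.ne (congrArg ω.order h.symm)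
  · have heq : ω.order s⁻¹ = ω.order t⁻¹ :=
      hQ.isConsistent.order_eq hs.inv_mem ht.inv_mem ((inv_inv s).trans_le hle)
    rw [ω.order_inv, ω.order_inv] at heq
    exact absurd heq hlt.ne'

theorem order_le_of_maximal {T : Set (UnorientedSeparation U)} (hT : IsNestedSet T)
    (hP : ω.IsProfileIn P) (hP' : ω.IsProfileIn P') (hQ : ω.IsProfileIn Q)
    (hPQ : P ≠ Q → ∃ t ∈ orientationsOf T, ω.EfficientlyDistinguishes t P Q)
    (hs : ω.EfficientlyDistinguishes s P' Q)
    (hmax : Maximal (fun x => x ∈ P ∩ orientationsOf T) s) {s' : U} (hs' : s' ∈ P)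
    (hss' : s ≤ s') : ω.order s ≤ ω.order s' := by
  by_contra! hlt
  have hne : P ≠ Q := by
    rintro rfl
    have heq : ω.order s⁻¹ = ω.order s' :=
      hP.isConsistent.order_eq hs.inv_mem hs' ((inv_inv s).trans_le hss')
    exact hlt.ne' ((ω.order_inv s).symm.trans heq)
  have hs'Q : s'⁻¹ ∈ Q := hQ.mem_of_le_of_order_lt hs.inv_mem (inv_le_inv_iff.2 hss')
    (by rwa [ω.order_inv, ω.order_inv])
  obtain ⟨t, htT, ht⟩ := hPQ hne
  have hst : s < t := ht.lt_of_nested hP hP' hQ hs hmax.prop.1 (hT _ htT _ hmax.prop.2)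
    ((ht.order_le s' hs' hs'Q).trans_lt hlt)
  exact hmax.not_prop_of_gt hst ⟨ht.mem, htT⟩

end SubmodularOrder

end Profiles

end SeparationTheory

open SeparationTheory in
theorem mainTheorem5_general {U : Type*} [SeparationUniverse U] (ω : SubmodularOrder U)
    (Ps : Set (Set U)) (hfin : Ps.Finite) (hprofile : ∀ P ∈ Ps, ω.IsProfileIn P)
    (hrobust : ∀ P ∈ Ps, ω.IsRobust P)
    (hdist : ∀ P ∈ Ps, ∀ Q ∈ Ps, P ≠ Q → Distinguishable P Q) :
    ∃ T : Set (UnorientedSeparation U), IsNestedSet T ∧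
      (∀ P ∈ Ps, ∀ Q ∈ Ps, P ≠ Q → ∃ s ∈ T, Distinguishes s P Q) ∧
      (∀ P ∈ Ps, ∀ s : U, Maximal (fun x => x ∈ P ∩ orientationsOf T) s →
        ∀ s' ∈ P, s ≤ s' → ω.order s ≤ ω.order s') := by
  obtain ⟨T, hT, hmeet, hsub⟩ :=
    SubmodularOrder.exists_isNestedSet_efficientlyDistinguishes hfin hprofile hrobust hdist
  refine ⟨T, hT, fun P hP Q hQ hne => ?_, fun P hP s hmax s' hs' hss' => ?_⟩
  · obtain ⟨s, hsT, hs⟩ := hmeet P hP Q hQ hne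
    exact ⟨underlying s, hsT, s, rfl, hs.mem, hs.inv_mem⟩
  · obtain ⟨P', hP', Q, hQ, hs⟩ := hsub s hmax.prop.2
    exact SubmodularOrder.order_le_of_maximal hT (hprofile P hP) (hprofile P' hP') (hprofile Q hQ)
      (hmeet P hP Q hQ) hs hmax hs' hss'

theorem mainTheorem5 {U : Type*} [SeparationTheory.SeparationUniverse U] [Finite U]
    (hU : SeparationTheory.IsDistributive U)
    (ω : SeparationTheory.SubmodularOrder U)
    (Ps : Set (Set U))
    (hprofile : ∀ P ∈ Ps, ω.IsProfileIn P)
    (hrobust : ∀ P ∈ Ps, ω.IsStronglyRobust P)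
    (hdist : ∀ P ∈ Ps, ∀ Q ∈ Ps, P ≠ Q → SeparationTheory.Distinguishable P Q) :
    ∃ T : Set (SeparationTheory.UnorientedSeparation U),
      SeparationTheory.IsNestedSet T ∧
      (∀ P ∈ Ps, ∀ Q ∈ Ps, P ≠ Q → ∃ s ∈ T, SeparationTheory.Distinguishes s P Q) ∧
      (∀ P ∈ Ps, ∀ s : U, Maximal (fun x => x ∈ P ∩ SeparationTheory.orientationsOf T) s →
        ∀ s' ∈ P, s ≤ s' → ω.order s ≤ ω.order s') :=
  mainTheorem5_general ω Ps Ps.toFinite hprofile (fun P hP => (hrobust P hP).isRobust) hdist
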